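/- Let $d\ge 2$ and let $\sigma_d:\mathbb R/\mathbb Z\to\mathbb R/\mathbb Z$, $\sigma_d(t)=dt \pmod 1$, where $t\in\mathbb R/\mathbb Z$ is identified with the point $e^{2\pi i t}$ of the unit circle. A leaf $\overline{ab}$ is the closed chord of the closed unit disk with (unordered) endpoints $a,b\in\mathbb R/\mathbb Z$; it is degenerate if $a=b$, and $\sigma_d(\overline{ab})=\overline{\sigma_d(a)\sigma_d(b)}$. A full sibling collection mapping onto a leaf $\ell$ is a set $\{\ell_1,\dots,\ell_d\}$ of $d$ leaves with $\sigma_d(\ell_i)=\ell$ for all $i$ and $\ell_i\cap\ell_j=\emptyset$ for all $i\ne j$. Let $\ell$ be a non-degenerate leaf that is not a diameter. Then the number of full sibling collections mapping onto $\ell$, where two collections are identified if a rotation of the circle carries one onto the other, is exactly $$N(d)=\frac1d\left(\frac1{d+1}\binom{2d}{d}+\sum_{n\mid d,\; 1\le n<d}\varphi\!\left(\frac dn\right)\binom{2n}{n}\right),$$ where $\varphi$ is Euler's totient function. -/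

import Mathlib

namespace Lamination

/-- A leaf, that is a chord of the closed unit disk, given by its unordered pair of endpoints on the
circle `ℝ / ℤ`. The two endpoints may coincide: then the leaf is degenerate. -/
abbrev Leaf : Type := Sym2 UnitAddCircle

/-- The chord of the closed unit disk (a closed straight segment in `ℂ`) carried by a leaf; the
parameter `t ∈ ℝ / ℤ` stands for the point `exp (2 π i t)` of the unit circle. -/
noncomputable def chord : Leaf → Set ℂ :=
  Sym2.lift ⟨fun a b => segment ℝ (AddCircle.toCircle a : ℂ) (AddCircle.toCircle b : ℂ),
    fun _ _ => segment_symm ℝ _ _⟩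

/-- A leaf is degenerate if its endpoints coincide. -/
def IsDegenerate (l : Leaf) : Prop := l.IsDiag

/-- The length of a leaf: the length in `ℝ / ℤ` of the shorter of the two arcs that its endpoints
bound, which is the distance of the endpoints in `ℝ / ℤ`. -/
noncomputable def length : Leaf → ℝ :=
  Sym2.lift ⟨fun a b => dist a b, fun a b => dist_comm a b⟩

/-- A diameter is a leaf of the maximal length `1 / 2`. -/
def IsDiameter (l : Leaf) : Prop := length l = 1 / 2

/-- The map induced on leaves by `σ_d : t ↦ d t (mod 1)`. -/
def sigma (d : ℕ) : Leaf → Leaf := Sym2.map fun t => d • t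

/-- The map induced on leaves by the rotation `t ↦ θ + t` of the circle. -/
def rotate (θ : UnitAddCircle) : Leaf → Leaf := Sym2.map fun t => θ + t

/-- `S` is a full sibling collection mapping onto the leaf `l` under `σ_d`: it consists of `d`
leaves which are pairwise disjoint as chords of the closed disk, and `σ_d` maps each of them
to `l`. -/
structure IsFullSiblingCollection (d : ℕ) (l : Leaf) (S : Set Leaf) : Prop where
  encard_eq : S.encard = d
  sigma_eq : ∀ m ∈ S, sigma d m = l
  disjoint : ∀ m ∈ S, ∀ m' ∈ S, m ≠ m' → Disjoint (chord m) (chord m')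

/-- The type of all full sibling collections mapping onto `l` under `σ_d`. -/
abbrev FullSiblingCollection (d : ℕ) (l : Leaf) : Type :=
  {S : Set Leaf // IsFullSiblingCollection d l S}

theorem rotate_zero (m : Leaf) : rotate 0 m = m := by
  induction m using Sym2.ind with | _ a b => simp [rotate]

theorem rotate_rotate (θ η : UnitAddCircle) (m : Leaf) :
    rotate θ (rotate η m) = rotate (θ + η) m := by
  induction m using Sym2.ind with | _ a b => simp [rotate, add_assoc]

/-- Two full sibling collections mapping onto `l` are identified if some rotation of the circle
carries one onto the other. -/
def rotationSetoid (d : ℕ) (l : Leaf) : Setoid (FullSiblingCollection d l) where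
  r S S' := ∃ θ : UnitAddCircle, rotate θ '' S.1 = S'.1
  iseqv :=
    { refl := fun S => ⟨0, by simp [rotate_zero]⟩
      symm := by
        rintro S S' ⟨θ, h⟩
        exact ⟨-θ, by rw [← h, Set.image_image]; simp [rotate_rotate, rotate_zero]⟩
      trans := by
        rintro S S' S'' ⟨θ, h⟩ ⟨η, h'⟩
        exact ⟨η + θ, by rw [← h', ← h, Set.image_image]; simp [rotate_rotate]⟩ }

end Lamination

/-! Lift the leaf to reals `x < y < x + 1`. The `2 * d` preimages of its endpoints alternate around
the circle. In a full sibling collection the `d` disjoint leaves must use every preimage exactly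
once, and disjointness of chords depends only on the cyclic order of their ends. Collections are
therefore noncrossing perfect matchings of the `2 * d` points, joining indices of opposite parity
(`fullSiblingCollectionEquiv`).

A rotation by `θ` between two collections makes the rotation by `d • θ` preserve the leaf. Since the
leaf is neither degenerate nor a diameter, `θ` is a multiple of `1 / d`, which moves indices by an
even number (`rotation_iff`). The classes are thus the orbits of `ZMod d`, counted by Burnside's
lemma (`card_orbits_mul`).

The matchings fixed by `k` are those invariant under `n = gcd d k`, and `φ (d / n)` residues have
this gcd. If `n < d`, a long chord would cross its translate, so an invariant matching unrolls to a
noncrossing matching of `ℤ` with period `2 * n`. Such a matching is determined by its `n` left ends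
per period, and every choice of `n` residues occurs, through the excursions of a periodic walk; this
gives the binomial coefficient (`card_invariant`). If `n = d`, invariance is automatic, and cutting
the circle open gives Dyck words and the Catalan number (`card_invariant_self`). -/

namespace Lamination

/-! ### Crossing of chords and cyclic order -/

/-- The point of the unit circle of `ℂ` with angle `2 π x`. -/
noncomputable abbrev circlePoint (x : ℝ) : ℂ := AddCircle.toCircle (x : UnitAddCircle)

theorem circlePoint_re (x : ℝ) : (circlePoint x).re = Real.cos (2 * Real.pi * x) := by
  simp [circlePoint, AddCircle.toCircle_apply_mk, Circle.coe_exp, Complex.exp_re]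

theorem circlePoint_im (x : ℝ) : (circlePoint x).im = Real.sin (2 * Real.pi * x) := by
  simp [circlePoint, AddCircle.toCircle_apply_mk, Circle.coe_exp, Complex.exp_im]

/-- Twice the signed area of the triangle `u v w`. -/
def signedArea (u v w : ℂ) : ℝ :=
  (v.re - u.re) * (w.im - u.im) - (v.im - u.im) * (w.re - u.re)

/-- Sum-to-product formulas factor the area, so that the orientation of a triangle can be read from
the order of the angles. -/
theorem signedArea_circlePoint (α β γ : ℝ) :
    signedArea (circlePoint α) (circlePoint β) (circlePoint γ) =
      4 * Real.sin (Real.pi * (β - α)) * Real.sin (Real.pi * (γ - α)) *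
        Real.sin (Real.pi * (γ - β)) := by
  have e : Real.pi * (γ - β) = Real.pi * (γ + α) - Real.pi * (β + α) := by ring
  have e1 : ∀ u v : ℝ, (2 * Real.pi * u - 2 * Real.pi * v) / 2 = Real.pi * (u - v) :=
    fun u v => by ring
  have e2 : ∀ u v : ℝ, (2 * Real.pi * u + 2 * Real.pi * v) / 2 = Real.pi * (u + v) :=
    fun u v => by ring
  simp only [signedArea, circlePoint_re, circlePoint_im, Real.cos_sub_cos, Real.sin_sub_sin, e1, e2]
  rw [e, Real.sin_sub]
  ring

theorem signedArea_pos {α β γ : ℝ} (h₁ : α < β) (h₂ : β < γ) (h₃ : γ < α + 1) :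
    0 < signedArea (circlePoint α) (circlePoint β) (circlePoint γ) := by
  have key : ∀ u : ℝ, 0 < u → u < 1 → 0 < Real.sin (Real.pi * u) := fun u h0 h1 =>
    Real.sin_pos_of_pos_of_lt_pi (mul_pos Real.pi_pos h0) (by nlinarith [Real.pi_pos])
  rw [signedArea_circlePoint]
  have := key (β - α) (by linarith) (by linarith)
  have := key (γ - α) (by linarith) (by linarith)
  have := key (γ - β) (by linarith) (by linarith)
  positivity

theorem signedArea_swap (u v w : ℂ) : signedArea u w v = -signedArea u v w := by
  simp only [signedArea]; ring

theorem signedArea_self_left (u v : ℂ) : signedArea u v u = 0 := by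
  simp only [signedArea]; ring

theorem signedArea_self_right (u v : ℂ) : signedArea u v v = 0 := by
  simp only [signedArea]; ring

theorem signedArea_combo (u v w z : ℂ) {p q : ℝ} (h : p + q = 1) :
    signedArea u v (p • w + q • z) = p * signedArea u v w + q * signedArea u v z := by
  obtain rfl : q = 1 - p := by linarith
  simp only [signedArea, Complex.add_re, Complex.add_im, Complex.real_smul, Complex.mul_re,
    Complex.mul_im, Complex.ofReal_re, Complex.ofReal_im]
  ring

/-- Two segments are disjoint if the endpoints of one lie strictly on the same side of the line
through the endpoints of the other. -/
theorem disjoint_segment {u v w z : ℂ} (h : 0 < signedArea u v w * signedArea u v z) :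
    Disjoint (segment ℝ u v) (segment ℝ w z) := by
  rw [Set.disjoint_left]
  rintro _ ⟨p, q, hp, hq, hpq, rfl⟩ ⟨p', q', hp', hq', hpq', he⟩
  -- A common point lies on the line `u v`, so its area is zero; yet it is a convex combination of
  -- two areas of the same strict sign.
  have h0 := signedArea_combo u v u v hpq
  rw [← he, signedArea_combo u v w z hpq', signedArea_self_left, signedArea_self_right] at h0
  have h1 : p' * signedArea u v w ^ 2 + q' * (signedArea u v w * signedArea u v z) = 0 := by
    linear_combination h0 * signedArea u v w
  have hw : signedArea u v w ≠ 0 := fun h' => by simp [h'] at h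
  rcases hp'.eq_or_lt with h' | h'
  · rw [← h', show q' = 1 by linarith] at h1
    linarith
  · have := mul_pos h' (sq_pos_of_ne_zero hw)
    linarith [mul_nonneg hq' h.le]

theorem disjoint_chord {α β γ δ : ℝ} (hαβ : α < β) (hβ : β < α + 1)
    (h : (α < γ ∧ γ < β ∧ α < δ ∧ δ < β) ∨ (β < γ ∧ γ < α + 1 ∧ β < δ ∧ δ < α + 1)) :
    Disjoint (chord s((α : UnitAddCircle), (β : UnitAddCircle)))
      (chord s((γ : UnitAddCircle), (δ : UnitAddCircle))) := by
  apply disjoint_segment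
  rcases h with ⟨h₁, h₂, h₃, h₄⟩ | ⟨h₁, h₂, h₃, h₄⟩
  · rw [signedArea_swap _ (circlePoint γ) (circlePoint β),
      signedArea_swap _ (circlePoint δ) (circlePoint β), neg_mul_neg]
    exact mul_pos (signedArea_pos h₁ h₂ hβ) (signedArea_pos h₃ h₄ hβ)
  · exact mul_pos (signedArea_pos hαβ h₁ h₂) (signedArea_pos hαβ h₃ h₄)

/-- In a convex quadrilateral `u v w z` the diagonals meet. -/
theorem not_disjoint_segment {u v w z : ℂ} (h₁ : 0 < signedArea v w z) (h₂ : 0 < signedArea u w z)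
    (h₃ : 0 < signedArea u v z) (h₄ : 0 < signedArea u v w) :
    ¬ Disjoint (segment ℝ u w) (segment ℝ v z) := by
  -- Both sides are twice the area of the quadrilateral, cut along either diagonal. The diagonals
  -- divide each other in the ratios of these areas, which gives the weights below.
  have hs : signedArea v w z + signedArea u v z = signedArea u w z + signedArea u v w := by
    simp only [signedArea]; ring
  set c := signedArea v w z + signedArea u v z with hc
  have hc0 : 0 < c := by positivity
  rw [Set.not_disjoint_iff]
  refine ⟨(signedArea v w z / c) • u + (signedArea u v z / c) • w,
    ⟨_, _, by positivity, by positivity, ?_, rfl⟩,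
    ⟨signedArea u w z / c, signedArea u v w / c, by positivity, by positivity, ?_, ?_⟩⟩
  · rw [← add_div, ← hc, div_self hc0.ne']
  · rw [← add_div, ← hs, div_self hc0.ne']
  · apply Complex.ext <;>
    · simp only [Complex.add_re, Complex.add_im, Complex.real_smul, Complex.mul_re,
        Complex.mul_im, Complex.ofReal_re, Complex.ofReal_im]
      field_simp
      simp only [signedArea]
      ring

theorem not_disjoint_chord {α β γ δ : ℝ} (h₁ : α < β) (h₂ : β < γ) (h₃ : γ < δ) (h₄ : δ < α + 1) :
    ¬ Disjoint (chord s((α : UnitAddCircle), (γ : UnitAddCircle)))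
      (chord s((β : UnitAddCircle), (δ : UnitAddCircle))) :=
  not_disjoint_segment (u := circlePoint α) (v := circlePoint β) (w := circlePoint γ)
    (z := circlePoint δ) (signedArea_pos h₂ h₃ (by linarith))
    (signedArea_pos (h₁.trans h₂) h₃ h₄) (signedArea_pos h₁ (h₂.trans h₃) h₄)
    (signedArea_pos h₁ h₂ (h₃.trans h₄))

theorem mem_chord_of_mem {u : UnitAddCircle} {m : Leaf} (h : u ∈ m) :
    (AddCircle.toCircle u : ℂ) ∈ chord m := by
  obtain ⟨v, rfl⟩ := h
  exact left_mem_segment ℝ _ _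

/-! ### Periodic noncrossing matchings of the integers -/

/-- A perfect matching `F` of `ℤ` without crossings that is invariant under translation by `2 * n`
and joins integers of opposite parity. -/
structure IsPeriodicMatching (n : ℕ) (F : ℤ → ℤ) : Prop where
  invol : ∀ i, F (F i) = i
  odd : ∀ i, Odd (F i - i)
  periodic : ∀ i, F (i + 2 * n) = F i + 2 * n
  noncrossing : ∀ i j, i < j → j < F i → F j ≤ F i

namespace IsPeriodicMatching

variable {n : ℕ} {F G : ℤ → ℤ}

theorem ne (hF : IsPeriodicMatching n F) (i : ℤ) : F i ≠ i := fun h => by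
  have := hF.odd i
  simp [h] at this

theorem periodic_mul (hF : IsPeriodicMatching n F) (i q : ℤ) :
    F (i + 2 * n * q) = F i + 2 * n * q := by
  induction q with
  | zero => simp
  | succ q ih => rw [mul_add, ← add_assoc, mul_one, hF.periodic, ih]; ring
  | pred q ih =>
    have := hF.periodic (i + 2 * n * (-q - 1))
    rw [show i + 2 * n * (-q - 1) + 2 * n = i + 2 * n * -(q : ℤ) by ring, ih] at this
    linarith

/-- An arc longer than the period would cross its own translate; an arc of exactly that length would
contradict the involution. -/
theorem lt_add (hF : IsPeriodicMatching n F) (hn : 0 < n) (i : ℤ) : F i < i + 2 * n := by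
  by_contra! h
  rcases h.eq_or_lt with h | h
  · have h1 := hF.periodic i
    rw [h, hF.invol] at h1
    omega
  · have := hF.noncrossing i (i + 2 * n) (by omega) h
    rw [hF.periodic] at this
    omega

theorem mem_Ioo (hF : IsPeriodicMatching n F) {i k : ℤ} (h₁ : i < k) (h₂ : k < F i) :
    i < F k ∧ F k < F i := by
  have hki : F k ≠ F i := fun h => by
    have := congrArg F h
    rw [hF.invol, hF.invol] at this
    omega
  refine ⟨?_, lt_of_le_of_ne (hF.noncrossing i k h₁ h₂) hki⟩
  by_contra! h
  rcases h.eq_or_lt with h | h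
  · rw [← h, hF.invol] at h₂
    omega
  · have := hF.noncrossing (F k) i h (by rwa [hF.invol])
    rw [hF.invol] at this
    omega

/-- Induction on arc length. Points strictly under the arc from `i` to `F i` have the same partners
in `F` and `G`, so if `G i ≠ F i` then `G i` lies beyond `F i`. As `F i` is a right end for `G` too,
its `G`-partner then has no possible place. -/
theorem eq_of_lt (hF : IsPeriodicMatching n F) (hG : IsPeriodicMatching n G)
    (h : ∀ i, i < F i ↔ i < G i) (m : ℕ) : ∀ i, i < F i → F i - i ≤ m → G i = F i := by
  induction m with
  | zero => intro i h₁ h₂; simp at h₂; omega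
  | succ m ih =>
    intro i hi hm
    have inner : ∀ k, i < k → k < F i → G k = F k := by
      intro k hk hk'
      obtain ⟨h₁, h₂⟩ := hF.mem_Ioo hk hk'
      rcases lt_or_gt_of_ne (hF.ne k) with h' | h'
      · have := ih (F k) (by rwa [hF.invol]) (by rw [hF.invol]; push_cast at hm; omega)
        rw [hF.invol] at this
        rw [← hG.invol (F k), this]
      · exact ih k h' (by push_cast at hm; omega)
    have mem : ∀ k, i < k → k < F i → i < G k ∧ G k < F i := fun k hk hk' => by
      rw [inner k hk hk']; exact hF.mem_Ioo hk hk'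
    by_contra hne
    have h₁ : i < G i := (h i).1 hi
    have h₂ : F i < G i := by
      by_contra! h₂
      have := mem (G i) h₁ (lt_of_le_of_ne h₂ hne)
      rw [hG.invol] at this
      omega
    have h₃ : G (F i) < F i := by
      refine lt_of_le_of_ne ?_ (hG.ne _)
      have := h (F i)
      rw [hF.invol] at this
      omega
    rcases lt_trichotomy (G (F i)) i with h₄ | h₄ | h₄
    · have := hG.noncrossing _ i h₄ (by rwa [hG.invol])
      rw [hG.invol] at this
      omega
    · apply hne
      rw [← h₄, hG.invol, h₄]
    · have := mem _ h₄ h₃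
      rw [hG.invol] at this
      omega

/-- A periodic matching is determined by the set of the left ends of its arcs. -/
theorem ext_of_lt_iff (hF : IsPeriodicMatching n F) (hG : IsPeriodicMatching n G)
    (h : ∀ i, i < F i ↔ i < G i) : F = G := by
  funext i
  rcases lt_or_gt_of_ne (hF.ne i) with h' | h'
  · have := hF.eq_of_lt hG h (i - F i).toNat (F i) (by rwa [hF.invol])
      (by rw [hF.invol]; omega)
    rw [hF.invol] at this
    rw [← hG.invol (F i), this]
  · exact (hF.eq_of_lt hG h (F i - i).toNat i h' (by omega)).symm

end IsPeriodicMatching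

/-! ### Excursions of a periodic height function -/

/-- `i` is the start and `j` the end of an excursion of the height function `h`. -/
def IsArc (h : ℤ → ℤ) (i j : ℤ) : Prop :=
  i < j ∧ h (j + 1) = h i ∧ ∀ k, i < k → k ≤ j → h i < h k

section Height

variable {h : ℤ → ℤ}

theorem IsArc.unique_right {i j j' : ℤ} (H : IsArc h i j) (H' : IsArc h i j') : j = j' := by
  by_contra hne
  rcases lt_or_gt_of_ne hne with hlt | hlt
  · have := H'.2.2 (j + 1) (by have := H.1; omega) (by omega)
    have := H.2.1
    omega
  · have := H.2.2 (j' + 1) (by have := H'.1; omega) (by omega)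
    have := H'.2.1
    omega

theorem IsArc.unique_left {i i' j : ℤ} (H : IsArc h i j) (H' : IsArc h i' j) : i = i' := by
  have e := H.2.1.symm.trans H'.2.1
  by_contra hne
  rcases lt_or_gt_of_ne hne with hlt | hlt
  · have := H.2.2 i' hlt H'.1.le
    omega
  · have := H'.2.2 i hlt H.1.le
    omega

variable (hs : ∀ i, h (i + 1) = h i + 1 ∨ h (i + 1) = h i - 1)
include hs

theorem IsArc.up {i j : ℤ} (H : IsArc h i j) : h (i + 1) = h i + 1 := by
  have := H.2.2 (i + 1) (by omega) (by have := H.1; omega)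
  have := hs i
  omega

theorem IsArc.down {i j : ℤ} (H : IsArc h i j) : h (j + 1) = h j - 1 := by
  have := H.2.2 j H.1 le_rfl
  have := hs j
  have := H.2.1
  omega

variable {n : ℕ} (hn : 0 < n) (hp : ∀ i, h (i + 2 * n) = h i)
include hn hp

theorem exists_isArc_right {i : ℤ} (hi : h (i + 1) = h i + 1) : ∃ j, IsArc h i j := by
  have hex : ∃ k : ℕ, h (i + 1 + k + 1) ≤ h i := by
    -- The time inspected is then `i + 2 * n`, where periodicity restores the height `h i`; the
    -- excursion ends just before the first return.
    refine ⟨2 * n - 2, ?_⟩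
    rw [show i + 1 + ((2 * n - 2 : ℕ) : ℤ) + 1 = i + 2 * n by omega, hp]
  classical
  have hmin : ∀ k, i < k → k ≤ i + 1 + Nat.find hex → h i < h k := by
    intro k hk hk'
    by_contra! hle
    have hk1 : i + 1 ≠ k := fun e => by rw [← e] at hle; omega
    refine Nat.find_min hex (m := (k - i - 2).toNat) (by omega) ?_
    rwa [show i + 1 + ((k - i - 2).toNat : ℤ) + 1 = k by omega]
  refine ⟨i + 1 + Nat.find hex, by omega, ?_, hmin⟩
  have h₁ := Nat.find_spec hex
  have h₂ := hmin (i + 1 + Nat.find hex) (by omega) le_rfl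
  have := hs (i + 1 + Nat.find hex)
  omega

theorem exists_isArc_left {j : ℤ} (hj : h (j + 1) = h j - 1) : ∃ i, IsArc h i j := by
  have hex : ∃ k : ℕ, h (j - 1 - k) ≤ h (j + 1) := by
    refine ⟨2 * n - 2, ?_⟩
    rw [← hp, show j - 1 - ((2 * n - 2 : ℕ) : ℤ) + 2 * n = j + 1 by omega]
  classical
  have hmin : ∀ k, j - 1 - Nat.find hex < k → k ≤ j → h (j + 1) < h k := by
    intro k hk hk'
    by_contra! hle
    have hk1 : j ≠ k := fun e => by rw [← e] at hle; omega
    refine Nat.find_min hex (m := (j - 1 - k).toNat) (by omega) ?_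
    rwa [show j - 1 - ((j - 1 - k).toNat : ℤ) = k by omega]
  have h₁ := Nat.find_spec hex
  have h₂ := hmin (j - 1 - Nat.find hex + 1) (by omega) (by omega)
  have h₃ := hs (j - 1 - Nat.find hex)
  have h₄ : h (j + 1) = h (j - 1 - Nat.find hex) := by omega
  exact ⟨j - 1 - Nat.find hex, by omega, h₄, fun k hk hk' => h₄ ▸ hmin k hk hk'⟩

/-- The excursions of a periodic height function form a periodic matching. -/
theorem exists_isPeriodicMatching : ∃ F, IsPeriodicMatching n F ∧
    (∀ i, i < F i ↔ h (i + 1) = h i + 1) ∧ ∀ i, i < F i → IsArc h i (F i) := by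
  have hex : ∀ i, ∃ j, IsArc h i j ∨ IsArc h j i := fun i => by
    rcases hs i with hi | hi
    · exact (exists_isArc_right hs hn hp hi).imp fun _ => Or.inl
    · exact (exists_isArc_left hs hn hp hi).imp fun _ => Or.inr
  -- Excursions start with an up step and end with a down step, so no integer is both a start and an
  -- end.
  have huniq : ∀ i j j', IsArc h i j ∨ IsArc h j i → IsArc h i j' ∨ IsArc h j' i → j = j' := by
    rintro i j j' (H | H) (H' | H')
    · exact H.unique_right H'
    · have := H.up hs
      have := H'.down hs
      omega
    · have := H.down hs
      have := H'.up hs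
      omega
    · exact H.unique_left H'
  have hpar : ∀ (i : ℤ) (k : ℕ), Even (h (i + k) - h i - k) := fun i k => by
    induction k with
    | zero => simp
    | succ k ih =>
      have := hs (i + k)
      obtain ⟨c, hc⟩ := ih
      push_cast
      rw [← add_assoc]
      rcases this with e | e <;> rw [e]
      · exact ⟨c, by omega⟩
      · exact ⟨c - 1, by omega⟩
  have hodd : ∀ i j, IsArc h i j → Odd (j - i) := fun i j H => by
    have := hpar i (j + 1 - i).toNat
    have h1 := H.1
    rw [show i + ((j + 1 - i).toNat : ℤ) = j + 1 by omega, H.2.1,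
      show ((j + 1 - i).toNat : ℤ) = j + 1 - i by omega] at this
    obtain ⟨c, hc⟩ := this
    exact ⟨-c - 1, by omega⟩
  have hshift : ∀ i j, IsArc h i j → IsArc h (i + 2 * n) (j + 2 * n) := fun i j H => by
    refine ⟨by have := H.1; omega, ?_, fun k hk hk' => ?_⟩
    · rw [add_right_comm, hp, hp, H.2.1]
    · rw [hp, ← sub_add_cancel k (2 * n : ℤ), hp]
      exact H.2.2 _ (by omega) (by omega)
  choose F hF using hex
  have hlt : ∀ i, i < F i → IsArc h i (F i) := fun i hi => by
    rcases hF i with H | H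
    · exact H
    · have := H.1
      omega
  refine ⟨F, ⟨fun i => ?_, fun i => ?_, fun i => ?_, fun i j hij hj => ?_⟩, fun i => ?_, hlt⟩
  · exact huniq (F i) _ _ (hF _) (hF i).symm
  · rcases hF i with H | H
    · exact hodd _ _ H
    · rw [← neg_sub]; exact (hodd _ _ H).neg
  · exact huniq (i + 2 * n) _ _ (hF _) ((hF i).imp (hshift _ _) (hshift _ _))
  -- If the arcs crossed, the height just after `F i` would be back at `h i < h j` while the
  -- excursion from `j` is still above `h j`.
  · by_contra! hlt'
    have H := hlt i (by omega)
    have H' := hlt j (by omega)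
    have h₁ := H.2.2 j hij hj.le
    have h₂ := H'.2.2 (F i + 1) (by omega) (by omega)
    have h₃ := H.2.1
    omega
  · constructor
    · exact fun hi => (hlt i hi).up hs
    · intro hi
      rcases hF i with H | H
      · exact H.1
      · have := H.down hs
        omega

end Height
-- Counting periodic matchings by their left ends
/-- The sum of the first `k` steps of the walk that steps up at the times in `T` and down at all
other times. -/
def walk (T : Finset ℕ) (k : ℕ) : ℤ := ∑ m ∈ Finset.range k, if m ∈ T then 1 else -1

theorem walk_zero (T : Finset ℕ) : walk T 0 = 0 := by simp [walk]

theorem walk_succ (T : Finset ℕ) (k : ℕ) :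
    walk T (k + 1) = walk T k + if k ∈ T then 1 else -1 := Finset.sum_range_succ _ _

theorem walk_eq {T : Finset ℕ} {k : ℕ} (hT : T ⊆ Finset.range k) : walk T k = 2 * T.card - k := by
  rw [walk, Finset.sum_ite, Finset.filter_mem_eq_inter, Finset.inter_eq_right.2 hT]
  have := Finset.card_filter_add_card_filter_not (s := Finset.range k) (· ∈ T)
  rw [Finset.filter_mem_eq_inter, Finset.inter_eq_right.2 hT, Finset.card_range] at this
  simp only [Finset.sum_const, nsmul_eq_mul]
  omega

/-- The left ends of the arcs of `F` in the fundamental domain `[0, 2 * n)`. -/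
def leftEnds (n : ℕ) (F : ℤ → ℤ) : Finset ℕ := {i ∈ Finset.range (2 * n) | (i : ℤ) < F i}

theorem leftEnds_subset (n : ℕ) (F : ℤ → ℤ) : leftEnds n F ⊆ Finset.range (2 * n) :=
  Finset.filter_subset _ _

theorem mem_leftEnds {n : ℕ} {F : ℤ → ℤ} {i : ℕ} (hi : i < 2 * n) :
    i ∈ leftEnds n F ↔ (i : ℤ) < F i := by
  simp [leftEnds, hi]

namespace IsPeriodicMatching

variable {n : ℕ} {F G : ℤ → ℤ}

theorem emod_lt_iff (hF : IsPeriodicMatching n F) (i : ℤ) :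
    i % (2 * n) < F (i % (2 * n)) ↔ i < F i := by
  have := hF.periodic_mul (i % (2 * n)) (i / (2 * n))
  rw [Int.emod_add_mul_ediv] at this
  rw [this]
  have := Int.emod_add_mul_ediv i (2 * n)
  omega

theorem toNat_emod_mem_leftEnds (hF : IsPeriodicMatching n F) (hn : 0 < n) (i : ℤ) :
    (i % (2 * n)).toNat ∈ leftEnds n F ↔ i < F i := by
  have h₁ := Int.emod_nonneg i (b := 2 * n) (by omega)
  have h₂ := Int.emod_lt_of_pos i (b := 2 * n) (by omega)
  rw [mem_leftEnds (by omega), Int.toNat_of_nonneg h₁, hF.emod_lt_iff]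

/-- Modulo `2 * n`, `F` is an involution pairing each up step with a down step, so the steps cancel.
-/
theorem walk_leftEnds (hF : IsPeriodicMatching n F) (hn : 0 < n) :
    walk (leftEnds n F) (2 * n) = 0 := by
  have hnn : ∀ i : ℤ, 0 ≤ i % (2 * n) := fun i => Int.emod_nonneg i (by omega)
  have hlt : ∀ i : ℤ, i % (2 * n) < 2 * n := fun i => Int.emod_lt_of_pos i (by omega)
  have hmem : ∀ i : ℕ, (F i % (2 * n)).toNat ∈ leftEnds n F ↔ F i < i := fun i => by
    rw [hF.toNat_emod_mem_leftEnds hn, hF.invol]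
  refine Finset.sum_involution (fun i _ => (F i % (2 * n)).toNat) ?_ ?_ ?_ ?_
  · intro i hi
    simp only [hmem, mem_leftEnds (Finset.mem_range.1 hi)]
    have := hF.ne i
    split_ifs <;> omega
  · intro i hi _ he
    have := hmem i
    rw [he, mem_leftEnds (Finset.mem_range.1 hi)] at this
    have := hF.ne i
    omega
  · intro i _
    have := hlt (F i)
    simp only [Finset.mem_range]
    omega
  · intro i hi
    simp only [Finset.mem_range] at hi
    have h₁ := hF.periodic_mul (F i % (2 * n)) (F i / (2 * n))
    rw [Int.emod_add_mul_ediv, hF.invol] at h₁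
    rw [Int.toNat_of_nonneg (hnn _), ← Int.add_mul_emod_self_left _ _ (F i / (2 * n)), ← h₁,
      Int.emod_eq_of_lt (by omega) (by omega), Int.toNat_natCast]

theorem card_leftEnds (hF : IsPeriodicMatching n F) (hn : 0 < n) : (leftEnds n F).card = n := by
  have := hF.walk_leftEnds hn
  rw [walk_eq (leftEnds_subset n F)] at this
  push_cast at this
  omega

theorem ext_of_leftEnds (hF : IsPeriodicMatching n F) (hG : IsPeriodicMatching n G) (hn : 0 < n)
    (h : leftEnds n F = leftEnds n G) : F = G :=
  hF.ext_of_lt_iff hG fun i => by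
    rw [← hF.toNat_emod_mem_leftEnds hn, h, hG.toNat_emod_mem_leftEnds hn]

end IsPeriodicMatching

/-- Every balanced set of left ends comes from a periodic matching, and this matching preserves the
blocks `[2 * n * q, 2 * n * (q + 1))` exactly if the associated walk is nonnegative. -/
theorem exists_leftEnds_eq {n : ℕ} (hn : 0 < n) {T : Finset ℕ} (hT : T ⊆ Finset.range (2 * n))
    (hc : T.card = n) : ∃ F, IsPeriodicMatching n F ∧ leftEnds n F = T ∧
      ((∀ i, F i / (2 * n) = i / (2 * n)) ↔ ∀ k ≤ 2 * n, 0 ≤ walk T k) := by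
  have hw : walk T (2 * n) = 0 := by rw [walk_eq hT, hc]; push_cast; ring
  have hnn : ∀ i : ℤ, 0 ≤ i % (2 * n) := fun i => Int.emod_nonneg i (by omega)
  have hlt : ∀ i : ℤ, i % (2 * n) < 2 * n := fun i => Int.emod_lt_of_pos i (by omega)
  -- The walk closes up after `2 * n` steps by `hw`, so its periodic extension is again a height
  -- function with steps `±1`.
  set h : ℤ → ℤ := fun i => walk T (i % (2 * n)).toNat with hdef
  have hnat : ∀ k : ℕ, k ≤ 2 * n → h k = walk T k := fun k hk => by
    rcases hk.eq_or_lt with rfl | hk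
    · simp [hdef, hw, walk_zero]
    · simp only [hdef]
      rw [Int.emod_eq_of_lt (by omega) (by omega), Int.toNat_natCast]
  have hp : ∀ i, h (i + 2 * n) = h i := fun i => by simp [hdef]
  have hstep : ∀ i, h (i + 1) = h i + if (i % (2 * n)).toNat ∈ T then 1 else -1 := fun i => by
    have e : h (i + 1) = h (((i % (2 * n)).toNat + 1 : ℕ) : ℤ) := by
      simp only [hdef]
      push_cast
      rw [Int.toNat_of_nonneg (hnn i), Int.emod_add_emod]
    have := hlt i
    have := hnn i
    rw [e, hnat _ (by omega), walk_succ]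
  have hs : ∀ i, h (i + 1) = h i + 1 ∨ h (i + 1) = h i - 1 := fun i => by
    rw [hstep]; split_ifs <;> omega
  obtain ⟨F, hF, hup, harc⟩ := exists_isPeriodicMatching hs hn hp
  have h0 : ∀ q : ℤ, h (2 * n * q) = 0 := fun q => by simp [hdef, walk_zero]
  have hdown : ∀ j, F j < j → IsArc h (F j) j := fun j hj => by
    have := harc (F j) (by rwa [hF.invol])
    rwa [hF.invol] at this
  refine ⟨F, hF, ?_, fun hb => ?_, fun hpos => ?_⟩
  · ext i
    by_cases hi : i < 2 * n
    · rw [mem_leftEnds hi, hup, hstep, Int.emod_eq_of_lt (by omega) (by omega), Int.toNat_natCast]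
      split_ifs with hT' <;> simp [hT']
    · exact iff_of_false (fun h' => hi (Finset.mem_range.1 (leftEnds_subset _ _ h')))
        (fun h' => hi (Finset.mem_range.1 (hT h')))
  · intro k
    induction k using Nat.strong_induction_on with
    | _ k ih =>
      intro hk
      -- The step into the first negative time goes down; its partner would be an earlier time of
      -- the same block with the same negative height.
      by_contra! hneg
      rcases k with _ | k
      · simp [walk_zero] at hneg
      have h₁ := ih k (by omega) (by omega)
      rw [← hnat _ (by omega)] at hneg h₁
      push_cast at hneg
      have hFk : F k < k := by
        refine lt_of_le_of_ne ?_ (hF.ne _)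
        have := hup k
        have := hs k
        omega
      have harc' := hdown k hFk
      have h₂ : 0 ≤ F k := by
        have := hb k
        rw [Int.ediv_eq_zero_of_lt (a := (k : ℤ)) (by omega) (by omega)] at this
        by_contra! h₃
        have := Int.ediv_neg_of_neg_of_pos h₃ (show (0 : ℤ) < 2 * n by omega)
        omega
      have h₃ := ih (F k).toNat (by omega) (by omega)
      rw [← hnat _ (by omega), Int.toNat_of_nonneg h₂, ← harc'.2.1] at h₃
      omega
  -- Heights are nonnegative and vanish at block boundaries, so no excursion can pass over a
  -- boundary.
  · have hpos' : ∀ i, 0 ≤ h i := fun i => hpos _ (by have := hlt i; omega)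
    have key : ∀ i j, IsArc h i j → i / (2 * n) = j / (2 * n) := fun i j H => by
      refine le_antisymm (Int.ediv_le_ediv (by omega) H.1.le) ?_
      by_contra! hlt'
      have h₁ : i < 2 * n * (j / (2 * n)) := by
        rw [mul_comm]; exact (Int.ediv_lt_iff_lt_mul (by omega)).1 hlt'
      have h₂ : 2 * n * (j / (2 * n)) ≤ j := Int.mul_ediv_self_le (by omega)
      have h₃ := H.2.2 _ h₁ h₂
      rw [h0] at h₃
      have := hpos' i
      omega
    intro i
    rcases lt_or_gt_of_ne (hF.ne i) with hi | hi
    · exact key _ _ (hdown i hi)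
    · exact (key _ _ (harc i hi)).symm

theorem card_periodicMatching {n : ℕ} (hn : 0 < n) :
    Nat.card {F // IsPeriodicMatching n F} = (2 * n).choose n := by
  have : Nat.card (Finset.powersetCard n (Finset.range (2 * n))) = (2 * n).choose n := by
    rw [Nat.card_eq_fintype_card, Fintype.card_coe, Finset.card_powersetCard, Finset.card_range]
  rw [← this]
  refine Nat.card_eq_of_bijective (fun F => ⟨leftEnds n F.1,
    Finset.mem_powersetCard.2 ⟨leftEnds_subset _ _, F.2.card_leftEnds hn⟩⟩) ⟨?_, ?_⟩
  · intro F G h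
    exact Subtype.ext (F.2.ext_of_leftEnds G.2 hn (congrArg Subtype.val h))
  · rintro ⟨T, hT⟩
    obtain ⟨hT, hc⟩ := Finset.mem_powersetCard.1 hT
    obtain ⟨F, hF, h, -⟩ := exists_leftEnds_eq hn hT hc
    exact ⟨⟨F, hF⟩, Subtype.ext h⟩

/-- The word of the first `k` steps of the walk associated with `T`. -/
def stepList (T : Finset ℕ) (k : ℕ) : List DyckStep :=
  (List.range k).map fun i => if i ∈ T then DyckStep.U else DyckStep.D

theorem count_stepList (T : Finset ℕ) (k : ℕ) :
    ((stepList T k).count DyckStep.U : ℤ) - (stepList T k).count DyckStep.D = walk T k := by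
  induction k with
  | zero => simp [stepList, walk_zero]
  | succ k ih =>
    rw [walk_succ, ← ih]
    simp only [stepList, List.range_succ, List.map_append, List.count_append]
    by_cases h : k ∈ T <;> simp [h] <;> ring

theorem take_stepList (T : Finset ℕ) (i k : ℕ) :
    (stepList T k).take i = stepList T (min i k) := by
  rw [stepList, ← List.map_take, List.take_range, stepList]

/-- Reading left ends as `U` and right ends as `D` over one block gives Dyck words of semilength
`n`. -/
theorem card_periodicMatching_block {n : ℕ} (hn : 0 < n) :
    Nat.card {F // IsPeriodicMatching n F ∧ ∀ i, F i / (2 * n) = i / (2 * n)} = catalan n := by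
  rw [← DyckWord.card_dyckWord_semilength_eq_catalan, ← Nat.card_eq_fintype_card]
  have hblock : ∀ F, IsPeriodicMatching n F → (∀ i, F i / (2 * n) = i / (2 * n)) →
      ∀ k ≤ 2 * n, 0 ≤ walk (leftEnds n F) k := fun F hF hb => by
    obtain ⟨G, hG, he, h⟩ := exists_leftEnds_eq hn (leftEnds_subset n F) (hF.card_leftEnds hn)
    rw [hG.ext_of_leftEnds hF hn he] at h
    exact h.1 hb
  have hcount : ∀ F, IsPeriodicMatching n F → (stepList (leftEnds n F) (2 * n)).count DyckStep.U =
      (stepList (leftEnds n F) (2 * n)).count DyckStep.D := fun F hF => by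
    have := count_stepList (leftEnds n F) (2 * n)
    rw [hF.walk_leftEnds hn] at this
    omega
  have htake : ∀ F, IsPeriodicMatching n F → (∀ i, F i / (2 * n) = i / (2 * n)) → ∀ i,
      ((stepList (leftEnds n F) (2 * n)).take i).count DyckStep.D ≤
        ((stepList (leftEnds n F) (2 * n)).take i).count DyckStep.U := fun F hF hb i => by
    have := hblock _ hF hb (min i (2 * n)) (min_le_right _ _)
    rw [← count_stepList, ← take_stepList] at this
    omega
  refine Nat.card_eq_of_bijective
    (fun F => ⟨⟨stepList (leftEnds n F.1) (2 * n), hcount _ F.2.1, htake _ F.2.1 F.2.2⟩, ?_⟩)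
    ⟨?_, ?_⟩
  · have := DyckWord.two_mul_semilength_eq_length
      (p := ⟨stepList (leftEnds n F.1) (2 * n), hcount _ F.2.1, htake _ F.2.1 F.2.2⟩)
    simp only [stepList, List.length_map, List.length_range] at this ⊢
    omega
  · intro F G h
    have h' : stepList (leftEnds n F.1) (2 * n) = stepList (leftEnds n G.1) (2 * n) :=
      congrArg (fun p => p.1.toList) h
    refine Subtype.ext (F.2.1.ext_of_leftEnds G.2.1 hn ?_)
    ext i
    by_cases hi : i < 2 * n
    · have := List.map_inj_left.1 h' i (List.mem_range.2 hi)
      by_cases h₁ : i ∈ leftEnds n F.1 <;> by_cases h₂ : i ∈ leftEnds n G.1 <;> simp_all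
    · exact iff_of_false (fun h' => hi (Finset.mem_range.1 (leftEnds_subset _ _ h')))
        (fun h' => hi (Finset.mem_range.1 (leftEnds_subset _ _ h')))
  · rintro ⟨p, hp⟩
    have hlen := p.two_mul_semilength_eq_length
    rw [hp] at hlen
    set T : Finset ℕ := {i ∈ Finset.range (2 * n) | p.toList[i]? = some DyckStep.U} with hT
    have hTs : T ⊆ Finset.range (2 * n) := Finset.filter_subset _ _
    have hl : stepList T (2 * n) = p.toList := by
      refine List.ext_getElem (by simp [stepList, hlen]) fun i h₁ h₂ => ?_
      have h₃ : i < 2 * n := by omega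
      rcases DyckStep.dichotomy p.toList[i] with h | h <;>
        simp [stepList, hT, h₃, h, List.getElem?_eq_getElem h₂]
    have hw : ∀ k ≤ 2 * n, 0 ≤ walk T k := fun k hk => by
      have := p.count_D_le_count_U k
      rw [← count_stepList, ← min_eq_left hk, ← take_stepList, hl]
      omega
    have hc : T.card = n := by
      have h₁ := walk_eq hTs
      have h₂ := p.count_U_eq_count_D
      rw [← count_stepList, hl] at h₁
      push_cast at h₁
      omega
    obtain ⟨F, hF, he, h⟩ := exists_leftEnds_eq hn hTs hc
    refine ⟨⟨F, hF, h.2 hw⟩, Subtype.ext (DyckWord.ext ?_)⟩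
    simp only [he, hl]

/-! ### Circular matchings and the action of `ZMod d` -/

/-- A relation on `ℤ` that describes a perfect matching without crossings of `2 * d` points on a
circle: the integer `i` stands for the point with index `i` modulo `2 * d`, and only points with
indices of opposite parity are joined. -/
structure IsCircularMatching (d : ℕ) (R : ℤ → ℤ → Prop) : Prop where
  symm : ∀ {i j : ℤ}, R i j → R j i
  odd : ∀ {i j : ℤ}, R i j → Odd (j - i)
  periodic : ∀ {i j : ℤ}, R i j → ∀ q : ℤ, R i (j + 2 * d * q)
  total : ∀ i, ∃ j, R i j
  unique : ∀ {i j k : ℤ}, R i j → R i k → (2 * d : ℤ) ∣ k - j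
  noncrossing : ∀ {i j k l : ℤ}, i < j → j < k → k < l → l < i + 2 * d → R i k → ¬ R j l

/-- The relation `R` translated by `2 * a`. -/
def shift (R : ℤ → ℤ → Prop) (a : ℤ) : ℤ → ℤ → Prop := fun i j => R (i - 2 * a) (j - 2 * a)

theorem shift_zero (R : ℤ → ℤ → Prop) : shift R 0 = R := by funext i j; simp [shift]

theorem shift_shift (R : ℤ → ℤ → Prop) (a b : ℤ) : shift (shift R a) b = shift R (a + b) := by
  funext i j
  simp only [shift]
  congr 1 <;> ring

/-- The translations that preserve a relation. -/
def shiftStabilizer (R : ℤ → ℤ → Prop) : AddSubgroup ℤ where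
  carrier := {a | shift R a = R}
  zero_mem' := shift_zero R
  add_mem' {a b} ha hb := by
    change shift R (a + b) = R
    rw [← shift_shift, show shift R a = R from ha, show shift R b = R from hb]
  neg_mem' {a} ha := by
    change shift R (-a) = R
    conv_lhs => rw [← show shift R a = R from ha]
    rw [shift_shift, add_neg_cancel, shift_zero]

theorem mem_shiftStabilizer {R : ℤ → ℤ → Prop} {a : ℤ} :
    a ∈ shiftStabilizer R ↔ shift R a = R := Iff.rfl

namespace IsCircularMatching

variable {d n : ℕ} {R : ℤ → ℤ → Prop}

theorem congr_right (hR : IsCircularMatching d R) {i j k : ℤ} (h : R i j)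
    (hk : (2 * d : ℤ) ∣ k - j) : R i k := by
  obtain ⟨q, hq⟩ := hk
  convert hR.periodic h q using 1
  omega

theorem shift (hR : IsCircularMatching d R) (a : ℤ) : IsCircularMatching d (shift R a) where
  symm h := hR.symm h
  odd h := by simpa using hR.odd h
  periodic {i j} h q := by
    simp only [Lamination.shift, add_sub_right_comm]
    exact hR.periodic h q
  total i := by
    obtain ⟨j, hj⟩ := hR.total (i - 2 * a)
    exact ⟨j + 2 * a, by simpa [Lamination.shift] using hj⟩
  unique h h' := by simpa using hR.unique h h'
  noncrossing h₁ h₂ h₃ h₄ h := hR.noncrossing (by omega) (by omega) (by omega) (by omega) h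

theorem mem_shiftStabilizer (hR : IsCircularMatching d R) : (d : ℤ) ∈ shiftStabilizer R := by
  have key : ∀ {i j} (q q' : ℤ), R i j → R (i + 2 * d * q) (j + 2 * d * q') := fun q q' h =>
    hR.symm (hR.periodic (hR.symm (hR.periodic h q')) q)
  funext i j
  refine propext ⟨fun h => ?_, fun h => ?_⟩
  · convert key 1 1 h using 1 <;> ring
  · change R (i - 2 * d) (j - 2 * d)
    convert key (-1) (-1) h using 1 <;> ring

/-- The stabilizer is a subgroup containing `d`, so Bézout's identity applies. -/
theorem mem_shiftStabilizer_iff (hR : IsCircularMatching d R) (m : ℕ) :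
    (m : ℤ) ∈ shiftStabilizer R ↔ ((d.gcd m : ℕ) : ℤ) ∈ shiftStabilizer R := by
  constructor
  · intro h
    rw [Nat.gcd_eq_gcd_ab]
    have := add_mem (zsmul_mem hR.mem_shiftStabilizer (d.gcdA m)) (zsmul_mem h (d.gcdB m))
    simpa only [smul_eq_mul, mul_comm] using this
  · intro h
    obtain ⟨q, hq⟩ := Nat.gcd_dvd_right d m
    have := zsmul_mem h q
    rw [smul_eq_mul, mul_comm] at this
    rw [hq]
    exact_mod_cast this

theorem shift_congr (hR : IsCircularMatching d R) {a b : ℤ} (h : (d : ℤ) ∣ b - a) :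
    Lamination.shift R a = Lamination.shift R b := by
  obtain ⟨q, hq⟩ := h
  have := zsmul_mem hR.mem_shiftStabilizer q
  rw [smul_eq_mul, mul_comm, ← hq, Lamination.mem_shiftStabilizer] at this
  conv_lhs => rw [← this]
  rw [shift_shift, sub_add_cancel]

end IsCircularMatching

/-- The type of all matchings without crossings of `2 * d` points on a circle. -/
abbrev CircularMatching (d : ℕ) : Type := {R : ℤ → ℤ → Prop // IsCircularMatching d R}

/-- The residue `k` acts as the rotation by `k / d`, which moves indices by `2 * k`; `shift_congr`
makes the choice of representative irrelevant. -/
instance (d : ℕ) [NeZero d] : AddAction (ZMod d) (CircularMatching d) where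
  vadd k R := ⟨shift R.1 k.val, R.2.shift _⟩
  zero_vadd R := Subtype.ext <| by
    change shift R.1 ((0 : ZMod d).val) = R.1
    simp [shift_zero]
  add_vadd k k' R := Subtype.ext <| by
    change shift R.1 ((k + k').val) = shift (shift R.1 k'.val) k.val
    rw [shift_shift]
    refine R.2.shift_congr ?_
    rw [ZMod.val_add, add_comm (k'.val : ℤ)]
    push_cast
    exact Int.dvd_self_sub_of_emod_eq rfl

theorem vadd_val (d : ℕ) [NeZero d] (k : ZMod d) (R : CircularMatching d) :
    (k +ᵥ R).1 = shift R.1 k.val := rfl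

/-! ### Counting invariant circular matchings -/

/-- The relation on `ℤ` induced by a periodic matching modulo `2 * d`. -/
def ofPeriodic (d : ℕ) (F : ℤ → ℤ) : ℤ → ℤ → Prop := fun i j => (2 * d : ℤ) ∣ j - F i

theorem IsPeriodicMatching.of_dvd {n d : ℕ} {F : ℤ → ℤ} (hF : IsPeriodicMatching n F)
    (h : n ∣ d) : IsPeriodicMatching d F where
  invol := hF.invol
  odd := hF.odd
  periodic i := by
    obtain ⟨q, rfl⟩ := h
    have := hF.periodic_mul i q
    push_cast
    rwa [← mul_assoc]
  noncrossing := hF.noncrossing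

theorem IsPeriodicMatching.isCircularMatching {d : ℕ} (hd : 0 < d) {F : ℤ → ℤ}
    (hF : IsPeriodicMatching d F) : IsCircularMatching d (ofPeriodic d F) where
  symm {i j} h := by
    obtain ⟨q, hq⟩ := h
    rw [ofPeriodic, show j = F i + 2 * d * q by omega, hF.periodic_mul, hF.invol]
    exact ⟨-q, by ring⟩
  odd {i j} h := by
    obtain ⟨q, hq⟩ := h
    rw [show j - i = (F i - i) + 2 * (d * q) by linear_combination hq]
    exact (hF.odd i).add_even (even_two_mul _)
  periodic {i j} h q := by
    rw [ofPeriodic, add_sub_right_comm]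
    exact dvd_add h (dvd_mul_right _ _)
  total i := ⟨F i, by simp [ofPeriodic]⟩
  unique {i j k} h h' := by
    have := dvd_sub h' h
    rwa [sub_sub_sub_cancel_right] at this
  noncrossing {i j k l} h₁ h₂ h₃ h₄ h h' := by
    have hlt : ∀ i, F i < i + 2 * d := hF.lt_add hd
    have hgt : ∀ i, i < F i + 2 * d := fun i => by
      have := hlt (F i)
      rwa [hF.invol] at this
    -- Arcs are shorter than `2 * d`, so a partner within one turn after `i` is `F i` or its next
    -- translate. In the four resulting cases the violated arc starts at `i`, `F j`, `j` and `F i`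
    -- respectively.
    have key : ∀ i k, (2 * d : ℤ) ∣ k - F i → i < k → k < i + 2 * d →
        k = F i ∨ k = F i + 2 * d := by
      rintro i k ⟨q, hq⟩ h₁ h₂
      have := hlt i
      have := hgt i
      have hq0 : 0 ≤ q := by
        by_contra! hneg
        nlinarith
      have hq1 : q ≤ 1 := by
        by_contra! hneg
        nlinarith
      obtain rfl | rfl : q = 0 ∨ q = 1 := by omega
      · left; linarith
      · right; linarith
    rcases key i k h (by omega) (by omega) with e | e <;>
      rcases key j l h' (by omega) (by omega) with e' | e'
    · have := hF.noncrossing i j (by omega) (by omega)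
      omega
    · have := hF.noncrossing (F j) i (by omega) (by rw [hF.invol]; omega)
      rw [hF.invol] at this
      omega
    · have := hF.noncrossing j k (by omega) (by omega)
      rw [e, hF.periodic, hF.invol] at this
      omega
    · have := hF.noncrossing (F i) (F j) (by omega) (by rw [hF.invol]; omega)
      rw [hF.invol, hF.invol] at this
      omega

theorem IsPeriodicMatching.mem_shiftStabilizer {n d : ℕ} {F : ℤ → ℤ}
    (hF : IsPeriodicMatching n F) : (n : ℤ) ∈ shiftStabilizer (ofPeriodic d F) := by
  funext i j
  have := hF.periodic (i - 2 * n)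
  rw [sub_add_cancel] at this
  simp only [shift, ofPeriodic, this]
  congr 1
  ring

/-- If `Q` selects exactly one representative modulo `2 * d` of each partner, the circular matchings
invariant under translation by `2 * n` correspond to the periodic matchings compatible with `Q`. -/
theorem card_invariant_eq {n d : ℕ} (hd : 0 < d) (hnd : n ∣ d) (Q : ℤ → ℤ → Prop)
    (hsymm : ∀ i j, Q i j → Q j i) (hshift : ∀ i j, Q i j → Q (i + 2 * n) (j + 2 * n))
    (huniq : ∀ i j k, Q i j → Q i k → (2 * d : ℤ) ∣ k - j → j = k)
    (hclose : ∀ i j k l, i < j → j < k → k < l → Q i k → Q j l → l < i + 2 * d)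
    (hex : ∀ R, IsCircularMatching d R → (n : ℤ) ∈ shiftStabilizer R → ∀ i, ∃ j, R i j ∧ Q i j) :
    Nat.card {R // IsCircularMatching d R ∧ (n : ℤ) ∈ shiftStabilizer R} =
      Nat.card {F // IsPeriodicMatching n F ∧ ∀ i, Q i (F i)} := by
  symm
  refine Nat.card_eq_of_bijective (fun F => ⟨ofPeriodic d F.1,
    (F.2.1.of_dvd hnd).isCircularMatching hd, F.2.1.mem_shiftStabilizer⟩) ⟨?_, ?_⟩
  · rintro ⟨F, hF, hFQ⟩ ⟨G, hG, hGQ⟩ h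
    refine Subtype.ext (funext fun i => huniq i _ _ (hFQ i) (hGQ i) ?_)
    have h' : ofPeriodic d F i (G i) = ofPeriodic d G i (G i) :=
      congrFun (congrFun (congrArg Subtype.val h) _) _
    change ofPeriodic d F i (G i)
    rw [h']
    simp [ofPeriodic]
  · rintro ⟨R, hR, hRn⟩
    choose F hFR hFQ using hex R hR hRn
    have huniq' : ∀ i j k, R i j → R i k → Q i j → Q i k → j = k := fun i j k h₁ h₂ h₃ h₄ =>
      huniq i j k h₃ h₄ (hR.unique h₁ h₂)
    have hadd : ∀ i j, R i j → R (i + 2 * n) (j + 2 * n) := fun i j h => by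
      rw [← show shift R n = R from hRn]
      simpa [shift] using h
    refine ⟨⟨F, ⟨fun i => ?_, fun i => hR.odd (hFR i), fun i => ?_, fun i j h₁ h₂ => ?_⟩, hFQ⟩,
      Subtype.ext ?_⟩
    · exact huniq' _ _ _ (hFR _) (hR.symm (hFR i)) (hFQ _) (hsymm _ _ (hFQ i))
    · exact huniq' _ _ _ (hFR _) (hadd _ _ (hFR i)) (hFQ _) (hshift _ _ (hFQ i))
    -- `hclose` confines the four ends to one turn of the circle, where circular noncrossing
    -- applies.
    · by_contra! h₃
      exact hR.noncrossing h₁ h₂ h₃ (hclose _ _ _ _ h₁ h₂ h₃ (hFQ i) (hFQ j)) (hFR i) (hFR j)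
    · funext i j
      exact propext ⟨fun h => hR.congr_right (hFR i) h, fun h => hR.unique (hFR i) h⟩

/-- Otherwise the chord would cross its translate by `2 * n`. Oddness of `j - i` excludes the
boundary cases in which ends coincide. -/
theorem IsCircularMatching.lt_add {n d : ℕ} {R : ℤ → ℤ → Prop} (hR : IsCircularMatching d R)
    (hRn : (n : ℤ) ∈ shiftStabilizer R) (hn : 0 < n) (_ : 2 * n ≤ d) {i j : ℤ} (h : R i j)
    (h₂ : j ≤ i + d) : j < i + 2 * n := by
  by_contra! h₃
  obtain ⟨c, hc⟩ := hR.odd h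
  have h' : R (i + 2 * n) (j + 2 * n) := by
    rw [← show Lamination.shift R n = R from hRn]
    simpa [Lamination.shift] using h
  exact hR.noncrossing (by omega) (by omega) (by omega) (by omega) h h'

/-- On the shorter side every chord spans less than `2 * n ≤ d`, so each index has exactly one
representative of its partner at distance less than `2 * n`. -/
theorem card_invariant {n d : ℕ} (hn : 0 < n) (hnd : n ∣ d) (hlt : n < d) :
    Nat.card {R // IsCircularMatching d R ∧ (n : ℤ) ∈ shiftStabilizer R} = (2 * n).choose n := by
  have h2n : 2 * n ≤ d := by
    obtain ⟨q, rfl⟩ := hnd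
    have : 2 ≤ q := by
      by_contra! hq
      interval_cases q <;> omega
    nlinarith
  rw [card_invariant_eq (by omega) hnd (fun i j => j < i + 2 * n ∧ i < j + 2 * n),
    ← card_periodicMatching hn]
  · refine Nat.card_congr (Equiv.subtypeEquivRight fun F => and_iff_left_of_imp fun hF i =>
      ⟨hF.lt_add hn i, ?_⟩)
    have := hF.lt_add hn (F i)
    rwa [hF.invol] at this
  · exact fun i j h => h.symm
  · intro i j h
    omega
  · intro i j k h₁ h₂ h₃
    have := Int.eq_zero_of_abs_lt_dvd h₃ (by rw [abs_lt]; omega)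
    omega
  · intro i j k l
    omega
  · intro R hR hRn i
    obtain ⟨j, hj⟩ := hR.total i
    have h₁ := Int.emod_nonneg (j - i) (b := 2 * d) (by omega)
    have h₂ := Int.emod_lt_of_pos (j - i) (b := 2 * d) (by omega)
    have h₃ := Int.emod_add_mul_ediv (j - i) (2 * d)
    have hk : R i (i + (j - i) % (2 * d)) := hR.congr_right hj
      ⟨-((j - i) / (2 * d)), by rw [mul_neg]; omega⟩
    set k := i + (j - i) % (2 * d)
    obtain ⟨c, hc⟩ := hR.odd hk
    by_cases hkd : k ≤ i + d
    · have := hR.lt_add hRn hn h2n hk hkd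
      exact ⟨k, hk, this, by omega⟩
    · have hk' : R i (k - 2 * d) := hR.congr_right hk ⟨-1, by ring⟩
      have := hR.lt_add hRn hn h2n (hR.symm hk') (by omega)
      exact ⟨_, hk', by omega, this⟩

/-- Here each partner is represented inside the block `[2 * d * q, 2 * d * (q + 1))` of the index
itself, which cuts the circle before index `0`. -/
theorem card_invariant_self {d : ℕ} (hd : 0 < d) :
    Nat.card {R // IsCircularMatching d R ∧ (d : ℤ) ∈ shiftStabilizer R} = catalan d := by
  have hb : (0 : ℤ) < 2 * d := by omega
  rw [card_invariant_eq hd dvd_rfl (fun i j => j / (2 * d) = i / (2 * d)),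
    ← card_periodicMatching_block hd]
  · exact fun i j h => h.symm
  · intro i j h
    rw [Int.add_ediv_of_dvd_right dvd_rfl, Int.add_ediv_of_dvd_right dvd_rfl, h]
  · intro i j k h₁ h₂ h₃
    rw [← Int.emod_add_mul_ediv j (2 * d), ← Int.emod_add_mul_ediv k (2 * d), h₁, h₂,
      (Int.modEq_iff_dvd.2 h₃ : j % (2 * d) = k % (2 * d))]
  · intro i j k l h₁ h₂ h₃ h₄ h₅
    have h₆ := Int.ediv_le_ediv hb h₁.le
    have h₇ := Int.ediv_le_ediv hb h₂.le
    have h₈ : l / (2 * d) = i / (2 * d) := by omega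
    have h₉ := Int.emod_add_mul_ediv l (2 * d)
    have h₁₀ := Int.emod_add_mul_ediv i (2 * d)
    have h₁₁ := Int.emod_lt_of_pos l hb
    have h₁₂ := Int.emod_nonneg i hb.ne'
    rw [h₈] at h₉
    omega
  · intro R hR _ i
    obtain ⟨j, hj⟩ := hR.total i
    refine ⟨j % (2 * d) + 2 * d * (i / (2 * d)), hR.congr_right hj ?_, ?_⟩
    · refine ⟨i / (2 * d) - j / (2 * d), ?_⟩
      have := Int.emod_add_mul_ediv j (2 * d)
      linear_combination this
    · rw [Int.add_mul_ediv_left _ _ hb.ne', Int.ediv_eq_zero_of_lt (Int.emod_nonneg _ hb.ne')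
        (Int.emod_lt_of_pos _ hb), zero_add]

/-! ### Burnside's lemma -/

theorem card_fixedBy (d : ℕ) [NeZero d] (k : ZMod d) :
    Nat.card (AddAction.fixedBy (CircularMatching d) k) =
      Nat.card {R // IsCircularMatching d R ∧ ((d.gcd k.val : ℕ) : ℤ) ∈ shiftStabilizer R} := by
  refine Nat.card_congr ((Equiv.subtypeEquivRight fun R => ?_).trans
    (Equiv.subtypeSubtypeEquivSubtypeInter _
      fun R => ((d.gcd k.val : ℕ) : ℤ) ∈ shiftStabilizer R))
  rw [AddAction.mem_fixedBy, ← R.2.mem_shiftStabilizer_iff, mem_shiftStabilizer, Subtype.ext_iff,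
    vadd_val]

theorem card_orbits_mul (d : ℕ) [NeZero d] :
    Nat.card (AddAction.orbitRel.Quotient (ZMod d) (CircularMatching d)) * d =
      catalan d + ∑ n ∈ d.properDivisors, (d / n).totient * (2 * n).choose n := by
  have hd : 0 < d := Nat.pos_of_ne_zero (NeZero.ne d)
  have hcat : catalan d ≠ 0 := by
    have := succ_mul_catalan_eq_centralBinom d
    have := Nat.centralBinom_pos d
    intro h
    simp_all
  -- `Nat.card` of an infinite type is `0`, so the nonzero Catalan number gives finiteness.
  have : Finite (CircularMatching d) := by
    apply Nat.finite_of_card_ne_zero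
    rw [← card_invariant_self hd] at hcat
    convert hcat using 1
    exact Nat.card_congr (Equiv.subtypeEquivRight fun R =>
      (and_iff_left_of_imp fun hR => hR.mem_shiftStabilizer).symm)
  have : Fintype (CircularMatching d) := Fintype.ofFinite _
  classical
  have hB := AddAction.sum_card_fixedBy_eq_card_orbits_mul_card_addGroup (ZMod d)
    (CircularMatching d)
  rw [ZMod.card, ← Nat.card_eq_fintype_card] at hB
  rw [AddAction.orbitRel.Quotient, ← hB]
  simp_rw [← Nat.card_eq_fintype_card, card_fixedBy]
  set c : ℕ → ℕ := fun n =>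
    Nat.card {R // IsCircularMatching d R ∧ (n : ℤ) ∈ shiftStabilizer R}
  calc ∑ k : ZMod d, c (d.gcd k.val) = ∑ m ∈ Finset.range d, c (d.gcd m) :=
        Finset.sum_nbij' (fun k => k.val) (fun m => (m : ZMod d))
          (fun k _ => Finset.mem_range.2 k.val_lt) (by simp) (by simp)
          (fun m hm => ZMod.val_cast_of_lt (Finset.mem_range.1 hm)) (by simp)
    _ = ∑ n ∈ d.divisors, ∑ m ∈ Finset.range d with d.gcd m = n, c (d.gcd m) :=
        (Finset.sum_fiberwise_of_maps_to
          (fun m _ => Nat.mem_divisors.2 ⟨Nat.gcd_dvd_left _ _, hd.ne'⟩) _).symm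
    _ = ∑ n ∈ d.divisors, (d / n).totient * c n := by
        refine Finset.sum_congr rfl fun n hn => ?_
        rw [Nat.totient_div_of_dvd (Nat.dvd_of_mem_divisors hn), ← smul_eq_mul,
          ← Finset.sum_const]
        exact Finset.sum_congr rfl fun m hm => by rw [(Finset.mem_filter.1 hm).2]
    _ = _ := by
        rw [← Nat.insert_self_properDivisors hd.ne', Finset.sum_insert (by simp), Nat.div_self hd,
          Nat.totient_one, one_mul, show c d = catalan d from card_invariant_self hd]
        congr 1
        refine Finset.sum_congr rfl fun n hn => ?_
        obtain ⟨h₁, h₂⟩ := Nat.mem_properDivisors.1 hn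
        rw [show c n = _ from card_invariant (Nat.pos_of_dvd_of_pos h₁ hd) h₁ h₂]

/-! ### Preimages under multiplication by `d` -/

theorem coe_eq_coe_iff (u v : ℝ) : (u : UnitAddCircle) = v ↔ ∃ n : ℤ, v = u + n := by
  rw [eq_comm, ← sub_eq_zero, ← AddCircle.coe_sub, AddCircle.coe_eq_zero_iff]
  simp only [zsmul_eq_mul, mul_one]
  exact exists_congr fun n => ⟨fun h => by linarith, fun h => by linarith⟩

theorem coe_ne_coe {x y : ℝ} (hxy : x < y) (hyx : y < x + 1) :
    (x : UnitAddCircle) ≠ y := fun h => by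
  obtain ⟨n, rfl⟩ := (coe_eq_coe_iff _ _).1 h
  have h₁ : (0 : ℝ) < n := by linarith
  have h₂ : (n : ℝ) < 1 := by linarith
  have h₃ : 0 < n := by exact_mod_cast h₁
  have h₄ : n < 1 := by exact_mod_cast h₂
  omega

theorem exists_eq_of_nsmul_eq {d : ℕ} (hd : 0 < d) {u : UnitAddCircle} {z : ℝ}
    (h : d • u = (z : UnitAddCircle)) : ∃ k : ℤ, u = ((z + k) / d : ℝ) := by
  obtain ⟨r, rfl⟩ := QuotientAddGroup.mk_surjective u
  have hd' : (d : ℝ) ≠ 0 := by positivity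
  change d • (r : UnitAddCircle) = z at h
  rw [← AddCircle.coe_nsmul, nsmul_eq_mul, eq_comm, coe_eq_coe_iff] at h
  obtain ⟨k, hk⟩ := h
  refine ⟨k, ?_⟩
  change (r : UnitAddCircle) = _
  rw [← hk, mul_div_cancel_left₀ _ hd']

theorem ncard_nsmul_fiber_le {d : ℕ} (hd : 0 < d) (z : ℝ) :
    {u : UnitAddCircle | d • u = (z : UnitAddCircle)}.Finite ∧
      {u : UnitAddCircle | d • u = (z : UnitAddCircle)}.ncard ≤ d := by
  have hd' : (d : ℝ) ≠ 0 := by positivity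
  have hsub : {u : UnitAddCircle | d • u = (z : UnitAddCircle)} ⊆
      ((Finset.range d).image fun k : ℕ => (((z + k) / d : ℝ) : UnitAddCircle) :
        Finset UnitAddCircle) := by
    intro u hu
    obtain ⟨k, rfl⟩ := exists_eq_of_nsmul_eq hd hu
    have h₁ := Int.emod_nonneg k (b := d) (by omega)
    have h₂ := Int.emod_lt_of_pos k (b := d) (by omega)
    rw [Finset.mem_coe, Finset.mem_image]
    refine ⟨(k % d).toNat, by simp; omega, (coe_eq_coe_iff _ _).2 ⟨k / d, ?_⟩⟩
    have h₃ : ((k % d).toNat : ℝ) = ((k % d : ℤ) : ℝ) := by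
      exact_mod_cast congrArg (Int.cast : ℤ → ℝ) (Int.toNat_of_nonneg h₁)
    have h₄ : (k : ℝ) = (k % d : ℤ) + d * (k / d : ℤ) := by
      exact_mod_cast (Int.emod_add_mul_ediv k d).symm
    rw [h₃, h₄]
    field_simp
    ring
  refine ⟨(Finset.finite_toSet _).subset hsub, ?_⟩
  refine (Set.ncard_le_ncard hsub (Finset.finite_toSet _)).trans ?_
  rw [Set.ncard_coe_finset]
  exact Finset.card_image_le.trans_eq (Finset.card_range d)

/-- Every preimage of an endpoint of `l` is an endpoint of a leaf of a full sibling collection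
mapping onto `l`. -/
theorem IsFullSiblingCollection.exists_mem {d : ℕ} (hd : 0 < d) {l : Leaf} {S : Set Leaf}
    (hS : IsFullSiblingCollection d l S) {u : UnitAddCircle} (hu : d • u ∈ l) :
    ∃ m ∈ S, u ∈ m := by
  have hex : ∀ m : S, ∃ v, v ∈ m.1 ∧ d • v = d • u := fun m => by
    rw [← hS.sigma_eq m m.2] at hu
    exact Sym2.mem_map.1 hu
  -- Each leaf of `S` has an end in the fibre through `u`, and disjoint leaves have different ends;
  -- `d` leaves thus exhaust a fibre of at most `d` points.
  choose e he₁ he₂ using hex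
  have hinj : Function.Injective e := fun m m' h => by
    by_contra hne
    refine Set.disjoint_left.1 (hS.disjoint m m.2 m' m'.2 fun h => hne (Subtype.ext h))
      (mem_chord_of_mem (he₁ m)) (h ▸ mem_chord_of_mem (he₁ m'))
  obtain ⟨z, hz⟩ := QuotientAddGroup.mk_surjective (d • u)
  obtain ⟨hfin, hcard⟩ := ncard_nsmul_fiber_le hd z
  have hrange : Set.range e = {v | d • v = (z : UnitAddCircle)} := by
    refine Set.eq_of_subset_of_ncard_le ?_ ?_ hfin
    · rintro _ ⟨m, rfl⟩
      exact (he₂ m).trans hz.symm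
    · refine hcard.trans_eq ?_
      rw [← Nat.card_coe_set_eq, Nat.card_range_of_injective hinj, Nat.card_coe_set_eq, Set.ncard,
        hS.encard_eq, ENat.toNat_natCast]
  obtain ⟨m, hm⟩ : u ∈ Set.range e := hrange ▸ hz.symm
  exact ⟨m, m.2, hm ▸ he₁ m⟩

/-! ### Full sibling collections as circular matchings -/

/-- The increasing enumeration by `ℤ` of the real numbers `(x + k) / d` and `(y + k) / d`. -/
noncomputable def liftPoint (d : ℕ) (x y : ℝ) (i : ℤ) : ℝ :=
  ((if Even i then x else y) + (i / 2 : ℤ)) / d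

/-- The point of `ℝ / ℤ` given by `liftPoint`: these are the preimages under `σ_d` of `x` and `y`. -/
noncomputable def point (d : ℕ) (x y : ℝ) (i : ℤ) : UnitAddCircle := liftPoint d x y i

/-- The relation "`i` and `j` are the indices of the endpoints of a leaf of `S`". -/
def toRel (d : ℕ) (x y : ℝ) (S : Set Leaf) : ℤ → ℤ → Prop :=
  fun i j => s(point d x y i, point d x y j) ∈ S

/-- The leaves joining the points whose indices are related by `R`. -/
def ofRel (d : ℕ) (x y : ℝ) (R : ℤ → ℤ → Prop) : Set Leaf :=
  {m | ∃ i j, R i j ∧ m = s(point d x y i, point d x y j)}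

section Points

variable {d : ℕ} {x y : ℝ}

theorem liftPoint_even (k : ℤ) : liftPoint d x y (2 * k) = (x + k) / d := by
  simp [liftPoint]

theorem liftPoint_odd (k : ℤ) : liftPoint d x y (2 * k + 1) = (y + k) / d := by
  have : ¬ Even (2 * k + 1) := by simp
  rw [liftPoint, if_neg this, show (2 * k + 1) / 2 = k by omega]

theorem liftPoint_add (i k : ℤ) : liftPoint d x y (i + 2 * k) = liftPoint d x y i + k / d := by
  obtain ⟨m, rfl | rfl⟩ := Int.even_or_odd' i
  · rw [← mul_add, liftPoint_even, liftPoint_even]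
    push_cast
    ring
  · rw [add_right_comm, ← mul_add, liftPoint_odd, liftPoint_odd]
    push_cast
    ring

theorem point_add (i k : ℤ) :
    point d x y (i + 2 * k) = point d x y i + ((k / d : ℝ) : UnitAddCircle) := by
  rw [point, point, liftPoint_add, AddCircle.coe_add]

variable (hd : 0 < d)
include hd

theorem liftPoint_add_period (i : ℤ) : liftPoint d x y (i + 2 * d) = liftPoint d x y i + 1 := by
  rw [liftPoint_add, Int.cast_natCast, div_self (by positivity)]

theorem nsmul_coe_div (z : ℝ) (k : ℤ) : d • (((z + k) / d : ℝ) : UnitAddCircle) = z := by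
  have hd' : (d : ℝ) ≠ 0 := by positivity
  rw [← AddCircle.coe_nsmul, nsmul_eq_mul, mul_div_cancel₀ _ hd', eq_comm, coe_eq_coe_iff]
  exact ⟨k, rfl⟩

theorem nsmul_point_even (k : ℤ) : d • point d x y (2 * k) = x := by
  rw [point, liftPoint_even, nsmul_coe_div hd]

theorem nsmul_point_odd (k : ℤ) : d • point d x y (2 * k + 1) = y := by
  rw [point, liftPoint_odd, nsmul_coe_div hd]

theorem nsmul_point_mem (i : ℤ) : d • point d x y i ∈ s((x : UnitAddCircle), (y : UnitAddCircle)) := by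
  obtain ⟨m, rfl | rfl⟩ := Int.even_or_odd' i
  · simp [nsmul_point_even hd]
  · simp [nsmul_point_odd hd]

theorem sigma_eq_of_odd {i j : ℤ} (h : Odd (j - i)) :
    sigma d s(point d x y i, point d x y j) = s((x : UnitAddCircle), (y : UnitAddCircle)) := by
  obtain ⟨c, hc⟩ := h
  simp only [sigma, Sym2.map_mk]
  obtain ⟨m, rfl | rfl⟩ := Int.even_or_odd' i
  · rw [show j = 2 * (m + c) + 1 by omega, nsmul_point_even hd, nsmul_point_odd hd]
  · rw [show j = 2 * (m + c + 1) by omega, nsmul_point_even hd, nsmul_point_odd hd, Sym2.eq_swap]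

theorem exists_of_sigma_eq {m : Leaf}
    (h : sigma d m = s((x : UnitAddCircle), (y : UnitAddCircle))) :
    ∃ i j, Odd (j - i) ∧ m = s(point d x y i, point d x y j) := by
  induction m using Sym2.ind with | _ u v =>
  have key : ∀ u v : UnitAddCircle, d • u = x → d • v = y →
      ∃ i j, Odd (j - i) ∧ s(u, v) = s(point d x y i, point d x y j) := fun u v hu hv => by
    obtain ⟨k, rfl⟩ := exists_eq_of_nsmul_eq hd hu
    obtain ⟨k', rfl⟩ := exists_eq_of_nsmul_eq hd hv
    exact ⟨2 * k, 2 * k' + 1, ⟨k' - k, by ring⟩, by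
      rw [point, point, liftPoint_even, liftPoint_odd]⟩
  rcases Sym2.eq_iff.1 h with ⟨hu, hv⟩ | ⟨hu, hv⟩
  · exact key u v hu hv
  · rw [Sym2.eq_swap]
    exact key v u hv hu

/-- A set of preimages of a leaf is determined by the relation it induces on the indices. -/
theorem eq_of_toRel_eq {S S' : Set Leaf}
    (hS : ∀ m ∈ S, sigma d m = s((x : UnitAddCircle), (y : UnitAddCircle)))
    (hS' : ∀ m ∈ S', sigma d m = s((x : UnitAddCircle), (y : UnitAddCircle)))
    (h : toRel d x y S = toRel d x y S') : S = S' := by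
  ext m
  constructor <;> intro hm
  · obtain ⟨i, j, -, rfl⟩ := exists_of_sigma_eq hd (hS m hm)
    exact (congrFun (congrFun h i) j).mp hm
  · obtain ⟨i, j, -, rfl⟩ := exists_of_sigma_eq hd (hS' m hm)
    exact (congrFun (congrFun h i) j).mpr hm

variable (hxy : x < y) (hyx : y < x + 1)
include hxy hyx

theorem odd_of_sigma_eq {i j : ℤ}
    (h : sigma d s(point d x y i, point d x y j) = s((x : UnitAddCircle), (y : UnitAddCircle))) :
    Odd (j - i) := by
  have hne := coe_ne_coe hxy hyx
  by_contra hodd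
  obtain ⟨c, hc⟩ := Int.not_odd_iff_even.1 hodd
  simp only [sigma, Sym2.map_mk] at h
  obtain ⟨m, rfl | rfl⟩ := Int.even_or_odd' i
  · rw [show j = 2 * (m + c) by omega, nsmul_point_even hd, nsmul_point_even hd] at h
    simp [hne] at h
  · rw [show j = 2 * (m + c) + 1 by omega, nsmul_point_odd hd, nsmul_point_odd hd] at h
    simp [hne.symm] at h

theorem liftPoint_strictMono : StrictMono (liftPoint d x y) := by
  have hd' : (0 : ℝ) < d := by positivity
  refine strictMono_int_of_lt_succ fun i => ?_
  obtain ⟨m, rfl | rfl⟩ := Int.even_or_odd' i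
  · rw [liftPoint_even, liftPoint_odd]
    gcongr
  · rw [show 2 * m + 1 + 1 = 2 * (m + 1) by ring, liftPoint_even, liftPoint_odd,
      div_lt_div_iff_of_pos_right hd']
    push_cast
    linarith

theorem point_eq_iff {i j : ℤ} : point d x y i = point d x y j ↔ (2 * d : ℤ) ∣ j - i := by
  have hadd : ∀ n : ℤ, liftPoint d x y (i + 2 * (d * n)) = liftPoint d x y i + n := fun n => by
    have hd' : (d : ℝ) ≠ 0 := by positivity
    rw [liftPoint_add]
    push_cast
    rw [mul_div_cancel_left₀ _ hd']
  rw [point, point, coe_eq_coe_iff]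
  refine exists_congr fun n => ?_
  rw [← hadd, (liftPoint_strictMono hd hxy hyx).injective.eq_iff]
  constructor <;> intro h <;> linear_combination h

theorem mem_iff_dvd {i j k : ℤ} : point d x y i ∈ s(point d x y j, point d x y k) ↔
    (2 * d : ℤ) ∣ j - i ∨ (2 * d : ℤ) ∣ k - i := by
  rw [Sym2.mem_iff, point_eq_iff hd hxy hyx, point_eq_iff hd hxy hyx]

theorem isCircularMatching_toRel {S : Set Leaf}
    (hS : IsFullSiblingCollection d s((x : UnitAddCircle), (y : UnitAddCircle)) S) :
    IsCircularMatching d (toRel d x y S) where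
  symm {i j} h := by
    rw [toRel, Sym2.eq_swap]
    exact h
  odd h := odd_of_sigma_eq hd hxy hyx (hS.sigma_eq _ h)
  periodic {i j} h q := by
    have : point d x y (j + 2 * d * q) = point d x y j :=
      ((point_eq_iff hd hxy hyx).2 ⟨q, by ring⟩).symm
    rw [toRel, this]
    exact h
  total i := by
    obtain ⟨m, hm, hi⟩ := hS.exists_mem hd (nsmul_point_mem hd i)
    obtain ⟨j, k, -, rfl⟩ := exists_of_sigma_eq hd (hS.sigma_eq m hm)
    rcases Sym2.mem_iff.1 hi with h | h
    · exact ⟨k, by rwa [toRel, h]⟩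
    · exact ⟨j, by rwa [toRel, h, Sym2.eq_swap]⟩
  unique {i j k} h h' := by
    rw [← point_eq_iff hd hxy hyx]
    by_contra hne
    exact Set.disjoint_left.1 (hS.disjoint _ h _ h' fun e => hne (Sym2.congr_right.1 e))
      (mem_chord_of_mem (Sym2.mem_mk_left _ _)) (mem_chord_of_mem (Sym2.mem_mk_left _ _))
  noncrossing {i j k l} h₁ h₂ h₃ h₄ h h' := by
    have hmono := liftPoint_strictMono hd hxy hyx
    refine not_disjoint_chord (hmono h₁) (hmono h₂) (hmono h₃)
      ((hmono h₄).trans_eq (liftPoint_add_period hd i)) (hS.disjoint _ h _ h' fun e => ?_)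
    have hmem : point d x y i ∈ s(point d x y i, point d x y k) := Sym2.mem_mk_left _ _
    rw [show s(point d x y i, point d x y k) = s(point d x y j, point d x y l) from e,
      mem_iff_dvd hd hxy hyx] at hmem
    rcases hmem with h | h
    · exact absurd (Int.le_of_dvd (by omega) h) (by omega)
    · exact absurd (Int.le_of_dvd (by omega) h) (by omega)

theorem toRel_ofRel {R : ℤ → ℤ → Prop} (hR : IsCircularMatching d R) :
    toRel d x y (ofRel d x y R) = R := by
  funext i j
  refine propext ⟨?_, fun h => ⟨i, j, h, rfl⟩⟩
  have key : ∀ i' j', R i' j' → point d x y i = point d x y i' →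
      point d x y j = point d x y j' → R i j := fun i' j' h hi hj =>
    hR.congr_right (hR.symm (hR.congr_right (hR.symm h)
      ((point_eq_iff hd hxy hyx).1 hi.symm))) ((point_eq_iff hd hxy hyx).1 hj.symm)
  rintro ⟨i', j', h, he⟩
  rcases Sym2.eq_iff.1 he with ⟨hi, hj⟩ | ⟨hi, hj⟩
  · exact key i' j' h hi hj
  · exact key j' i' (hR.symm h) hi hj

theorem exists_point_eq_of_emod (i k : ℤ) :
    ∃ k', i ≤ k' ∧ k' < i + 2 * d ∧ (2 * d : ℤ) ∣ k' - k ∧ point d x y k = point d x y k' := by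
  have h : (2 * d : ℤ) ∣ i + (k - i) % (2 * d) - k := by
    refine ⟨-((k - i) / (2 * d)), ?_⟩
    have := Int.emod_add_mul_ediv (k - i) (2 * d)
    linear_combination this
  have h₁ := Int.emod_nonneg (k - i) (b := 2 * d) (by omega)
  have h₂ := Int.emod_lt_of_pos (k - i) (b := 2 * d) (by omega)
  exact ⟨_, by omega, by omega, h, (point_eq_iff hd hxy hyx).2 h⟩

theorem isFullSiblingCollection_ofRel {R : ℤ → ℤ → Prop} (hR : IsCircularMatching d R) :
    IsFullSiblingCollection d s((x : UnitAddCircle), (y : UnitAddCircle)) (ofRel d x y R) where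
  sigma_eq := by
    rintro _ ⟨i, j, h, rfl⟩
    exact sigma_eq_of_odd hd (hR.odd h)
  encard_eq := by
    choose f hf using hR.total
    -- Every leaf has exactly one end of even index, so the `d` even residues modulo `2 * d`
    -- enumerate the leaves.
    have hinj : Function.Injective fun k : Fin d =>
        s(point d x y (2 * (k : ℤ)), point d x y (f (2 * (k : ℤ)))) := by
      intro k k' h
      have hmem : point d x y (2 * (k : ℤ)) ∈
          s(point d x y (2 * (k : ℤ)), point d x y (f (2 * (k : ℤ)))) := Sym2.mem_mk_left _ _
      rw [show s(point d x y (2 * (k : ℤ)), point d x y (f (2 * (k : ℤ)))) = _ from h,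
        mem_iff_dvd hd hxy hyx] at hmem
      rcases hmem with h | ⟨q, hq⟩
      · have := k.2
        have := k'.2
        have := Int.eq_zero_of_abs_lt_dvd h (by rw [abs_lt]; omega)
        exact Fin.ext (by omega)
      · obtain ⟨c, hc⟩ := hR.odd (hf (2 * (k' : ℤ)))
        rw [mul_assoc] at hq
        omega
    have hrange : ofRel d x y R = Set.range fun k : Fin d =>
        s(point d x y (2 * (k : ℤ)), point d x y (f (2 * (k : ℤ)))) := by
      have key : ∀ i j, R (2 * i) j → ∃ k : Fin d,
          s(point d x y (2 * (k : ℤ)), point d x y (f (2 * (k : ℤ)))) =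
            s(point d x y (2 * i), point d x y j) := fun i j h => by
        have h₁ := Int.emod_nonneg i (b := d) (by omega)
        have h₂ := Int.emod_lt_of_pos i (b := d) (by omega)
        have h₃ := Int.emod_add_mul_ediv i d
        have hdvd : (2 * d : ℤ) ∣ 2 * i - 2 * (i % d) := ⟨i / d, by linear_combination -2 * h₃⟩
        refine ⟨⟨(i % d).toNat, by omega⟩, ?_⟩
        simp only [Int.toNat_of_nonneg h₁]
        rw [(point_eq_iff hd hxy hyx).2 hdvd, Sym2.congr_right, point_eq_iff hd hxy hyx]
        exact hR.unique (hR.symm (hR.congr_right (hR.symm (hf _)) hdvd)) h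
      ext m
      constructor
      · rintro ⟨i, j, h, rfl⟩
        obtain ⟨c, hc⟩ := hR.odd h
        obtain ⟨m, rfl | rfl⟩ := Int.even_or_odd' i
        · exact key m j h
        · obtain rfl : j = 2 * (m + c + 1) := by omega
          rw [Sym2.eq_swap]
          exact key _ _ (hR.symm h)
      · rintro ⟨k, rfl⟩
        exact ⟨_, _, hf _, rfl⟩
    rw [hrange, ← Set.image_univ, hinj.encard_image, Set.encard_univ]
    simp
  disjoint := by
    rintro _ ⟨i, j, h, rfl⟩ _ ⟨k, l, h', rfl⟩ hne
    have hmono := liftPoint_strictMono hd hxy hyx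
    -- With all indices in one turn starting at `i`, noncrossing puts `k'` and `l'` on the same side
    -- of `j'`, as `disjoint_chord` requires.
    obtain ⟨j', hj₁, hj₂, hj₃, hj⟩ := exists_point_eq_of_emod hd hxy hyx i j
    obtain ⟨k', hk₁, hk₂, hk₃, hk⟩ := exists_point_eq_of_emod hd hxy hyx i k
    obtain ⟨l', hl₁, hl₂, hl₃, hl⟩ := exists_point_eq_of_emod hd hxy hyx i l
    rw [hj, hk, hl] at hne
    rw [hj, hk, hl]
    have hij : R i j' := hR.congr_right h hj₃
    have hkl : R k' l' :=
      hR.symm (hR.congr_right (hR.symm (hR.congr_right h' hl₃)) hk₃)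
    have hne' : ∀ a b c, R a b → R a c → point d x y b = point d x y c := fun a b c h h' =>
      (point_eq_iff hd hxy hyx).2 (hR.unique h h')
    obtain ⟨c, hc⟩ := hR.odd hij
    have hki : k' ≠ i := fun e => hne (by rw [e, hne' i l' j' (e ▸ hkl) hij])
    have hkj : k' ≠ j' := fun e => hne (by
      rw [e, Sym2.eq_swap, hne' j' i l' (hR.symm hij) (e ▸ hkl)])
    have hli : l' ≠ i := fun e => hne (by
      rw [e, Sym2.eq_swap, hne' i k' j' (e ▸ hR.symm hkl) hij])
    have hlj : l' ≠ j' := fun e => hne (by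
      rw [e, hne' j' i k' (hR.symm hij) (e ▸ hR.symm hkl)])
    have hperiod := liftPoint_add_period (x := x) (y := y) hd i
    refine disjoint_chord (hmono (by omega)) (hperiod ▸ hmono hj₂) ?_
    rcases lt_or_gt_of_ne hkj with hk' | hk' <;> rcases lt_or_gt_of_ne hlj with hl' | hl'
    · exact Or.inl ⟨hmono (by omega), hmono hk', hmono (by omega), hmono hl'⟩
    · exact (hR.noncrossing (by omega) hk' hl' hl₂ hij hkl).elim
    · exact (hR.noncrossing (by omega) hl' hk' hk₂ hij (hR.symm hkl)).elim
    · exact Or.inr ⟨hmono hk', hperiod ▸ hmono hk₂, hmono hl', hperiod ▸ hmono hl₂⟩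

/-- Full sibling collections correspond to matchings without crossings. -/
noncomputable def fullSiblingCollectionEquiv :
    FullSiblingCollection d s((x : UnitAddCircle), (y : UnitAddCircle)) ≃ CircularMatching d where
  toFun S := ⟨toRel d x y S.1, isCircularMatching_toRel hd hxy hyx S.2⟩
  invFun R := ⟨ofRel d x y R.1, isFullSiblingCollection_ofRel hd hxy hyx R.2⟩
  left_inv S := Subtype.ext <| eq_of_toRel_eq hd
    (isFullSiblingCollection_ofRel hd hxy hyx (isCircularMatching_toRel hd hxy hyx S.2)).sigma_eq
    S.2.sigma_eq (toRel_ofRel hd hxy hyx (isCircularMatching_toRel hd hxy hyx S.2))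
  right_inv R := Subtype.ext (toRel_ofRel hd hxy hyx R.2)

end Points

/-! ### Rotations of collections -/

theorem rotate_injective (θ : UnitAddCircle) : Function.Injective (rotate θ) :=
  Sym2.map.injective (add_right_injective θ)

theorem toRel_rotate (d : ℕ) (x y : ℝ) (S : Set Leaf) (k : ℤ) :
    toRel d x y (rotate ((k / d : ℝ) : UnitAddCircle) '' S) = shift (toRel d x y S) k := by
  funext i j
  have h : ∀ i, point d x y i = ((k / d : ℝ) : UnitAddCircle) + point d x y (i - 2 * k) :=
    fun i => by rw [add_comm, ← point_add, sub_add_cancel]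
  have : s(point d x y i, point d x y j) = rotate ((k / d : ℝ) : UnitAddCircle)
      s(point d x y (i - 2 * k), point d x y (j - 2 * k)) := by
    rw [rotate, Sym2.map_mk, ← h, ← h]
  rw [toRel, this, (rotate_injective _).mem_set_image]
  rfl

theorem sigma_rotate (d : ℕ) (θ : UnitAddCircle) (m : Leaf) :
    sigma d (rotate θ m) = rotate (d • θ) (sigma d m) := by
  induction m using Sym2.ind with | _ u v => simp [sigma, rotate]

/-- Only the trivial rotation preserves a nondegenerate leaf that is not a diameter. -/
theorem eq_zero_of_rotate_eq {θ : UnitAddCircle} {l : Leaf} (hl : ¬ IsDegenerate l)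
    (hl' : ¬ IsDiameter l) (h : rotate θ l = l) : θ = 0 := by
  induction l using Sym2.ind with | _ a b =>
  rw [rotate, Sym2.map_mk, Sym2.eq_iff] at h
  rcases h with ⟨h, -⟩ | ⟨h₁, h₂⟩
  · exact add_eq_right.1 h
  · refine absurd ?_ hl'
    have hab : a ≠ b := fun e => hl e
    -- The rotation swaps the ends, so `b - a` and `a - b` both equal `θ`; hence `b - a` is the half
    -- turn and the leaf a diameter.
    have h2 : (2 : ℕ) • (b - a) = ((0 : ℝ) : UnitAddCircle) := by
      rw [AddCircle.coe_zero, two_nsmul]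
      nth_rewrite 1 [← h₁]
      nth_rewrite 2 [← h₂]
      abel
    obtain ⟨k, hk⟩ := exists_eq_of_nsmul_eq two_pos h2
    have hhalf : b - a = ((1 / 2 : ℝ) : UnitAddCircle) := by
      obtain ⟨c, rfl | rfl⟩ := Int.even_or_odd' k
      · refine absurd ?_ (sub_ne_zero.2 hab.symm)
        rw [hk, ← AddCircle.coe_zero, eq_comm, coe_eq_coe_iff]
        exact ⟨c, by push_cast; ring⟩
      · rw [hk, eq_comm, coe_eq_coe_iff]
        exact ⟨c, by push_cast; ring⟩
    change dist a b = 1 / 2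
    rw [dist_comm, dist_eq_norm, hhalf, AddCircle.norm_half_period_eq, abs_one]

theorem exists_lift {l : Leaf} (hl : ¬ IsDegenerate l) :
    ∃ x y : ℝ, x < y ∧ y < x + 1 ∧ l = s((x : UnitAddCircle), (y : UnitAddCircle)) := by
  induction l using Sym2.ind with | _ a b =>
  have hab : a ≠ b := fun e => hl e
  obtain ⟨x, rfl⟩ := QuotientAddGroup.mk_surjective a
  have hb : b ∈ ((↑) : ℝ → UnitAddCircle) '' Set.Ico x (x + 1) := by
    rw [AddCircle.coe_image_Ico_eq]
    exact Set.mem_univ _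
  obtain ⟨y, ⟨h₁, h₂⟩, rfl⟩ := hb
  exact ⟨x, y, lt_of_le_of_ne h₁ fun e => hab (by rw [e]), h₂, rfl⟩

theorem rotation_iff {d : ℕ} [NeZero d] {x y : ℝ} (hd : 0 < d) (hxy : x < y) (hyx : y < x + 1)
    (hl : ¬ IsDegenerate s((x : UnitAddCircle), (y : UnitAddCircle)))
    (hl' : ¬ IsDiameter s((x : UnitAddCircle), (y : UnitAddCircle)))
    (S S' : FullSiblingCollection d s((x : UnitAddCircle), (y : UnitAddCircle))) :
    (∃ θ, rotate θ '' S.1 = S'.1) ↔ ∃ k : ZMod d,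
      k +ᵥ fullSiblingCollectionEquiv hd hxy hyx S = fullSiblingCollectionEquiv hd hxy hyx S' := by
  have hzero : ∀ k : ℤ, d • ((k / d : ℝ) : UnitAddCircle) = 0 := fun k => by
    simpa using nsmul_coe_div hd 0 k
  have hval : ∀ k : ZMod d, k +ᵥ fullSiblingCollectionEquiv hd hxy hyx S =
      fullSiblingCollectionEquiv hd hxy hyx S' ↔
        shift (toRel d x y S.1) k.val = toRel d x y S'.1 := fun k => Subtype.ext_iff
  simp_rw [hval]
  constructor
  · rintro ⟨θ, h⟩
    obtain ⟨m, hm⟩ : S.1.Nonempty := by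
      rw [← Set.encard_ne_zero, S.2.encard_eq]
      exact_mod_cast hd.ne'
    -- `σ_d` turns rotation by `θ` into rotation by `d • θ`, which must preserve the common image
    -- leaf.
    have hθ : d • θ = ((0 : ℝ) : UnitAddCircle) := by
      refine eq_zero_of_rotate_eq hl hl' ?_
      rw [← S.2.sigma_eq m hm, ← sigma_rotate, S.2.sigma_eq m hm]
      exact S'.2.sigma_eq _ (h ▸ Set.mem_image_of_mem _ hm)
    obtain ⟨k, rfl⟩ := exists_eq_of_nsmul_eq hd hθ
    rw [zero_add] at h
    refine ⟨(k : ZMod d), ?_⟩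
    rw [← h, toRel_rotate]
    refine (isCircularMatching_toRel hd hxy hyx S.2).shift_congr ?_
    rw [ZMod.val_intCast]
    exact Int.dvd_self_sub_of_emod_eq rfl
  · rintro ⟨k, h⟩
    refine ⟨(((k.val : ℤ) / d : ℝ) : UnitAddCircle), eq_of_toRel_eq hd ?_ S'.2.sigma_eq ?_⟩
    · rintro _ ⟨m, hm, rfl⟩
      rw [sigma_rotate, hzero, rotate_zero, S.2.sigma_eq m hm]
    · rw [toRel_rotate, h]

end Lamination

theorem theorem3p1 (d : ℕ) (hd : 2 ≤ d) (l : Lamination.Leaf)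
    (hl : ¬ Lamination.IsDegenerate l) (hl' : ¬ Lamination.IsDiameter l) :
    (Nat.card (Quotient (Lamination.rotationSetoid d l)) : ℚ) =
      1 / (d : ℚ) * (1 / ((d : ℚ) + 1) * ((2 * d).choose d : ℚ) +
        ∑ n ∈ d.properDivisors, (Nat.totient (d / n) : ℚ) * ((2 * n).choose n : ℚ)) := by
  have hd0 : 0 < d := by omega
  have : NeZero d := ⟨hd0.ne'⟩
  obtain ⟨x, y, hxy, hyx, rfl⟩ := Lamination.exists_lift hl
  have hcard : Nat.card (Quotient (Lamination.rotationSetoid d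
      s((x : UnitAddCircle), (y : UnitAddCircle)))) =
      Nat.card (AddAction.orbitRel.Quotient (ZMod d) (Lamination.CircularMatching d)) := by
    refine Nat.card_congr (Quotient.congr (Lamination.fullSiblingCollectionEquiv hd0 hxy hyx)
      fun S S' => ?_)
    refine (Lamination.rotation_iff hd0 hxy hyx hl hl' S S').trans ?_
    -- `orbitRel` relates `R` to `R'` when `R` lies in the orbit of `R'`, hence the reversal.
    exact ⟨fun h => Setoid.symm' _ h, fun h => Setoid.symm' (AddAction.orbitRel _ _) h⟩
  have hd1 : (d : ℚ) ≠ 0 := by positivity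
  have hd2 : (d : ℚ) + 1 ≠ 0 := by positivity
  have hcat : ((2 * d).choose d : ℚ) = ((d : ℚ) + 1) * catalan d := by
    have := succ_mul_catalan_eq_centralBinom d
    rw [Nat.centralBinom_eq_two_mul_choose] at this
    exact_mod_cast this.symm
  have horb := congrArg (Nat.cast : ℕ → ℚ) (Lamination.card_orbits_mul d)
  push_cast at horb
  rw [hcard, hcat, ← mul_assoc, one_div_mul_cancel hd2, one_mul, ← horb]
  field_simp
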